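/- Let $H$ be a locally compact (Hausdorff) unimodular group with Haar measure $dh$, and let $\pi$ be a strongly continuous unitary representation of $H$ on a complex Hilbert space $\mathcal H$, with inner product $(\cdot,\cdot)$ linear in the first entry. Let $C_c(H)$ carry the convolution $(f*g)(k)=\int_H f(h)g(h^{-1}k)\,dh$ and the involution $f^*(h)=\overline{f(h^{-1})}$; for a unitary representation $\sigma$ of $H$ put $\sigma(f)=\int_H f(h)\sigma(h)\,dh$, and let $C^*(H)$ be the group $C^*$-algebra, i.e. the completion of $C_c(H)$ in the norm $\sup_\sigma\|\sigma(f)\|$, the supremum being over all unitary representations $\sigma$ of $H$. Put $\pi^-(f)=\int_H f(h)\pi(h^{-1})\,dh$. Let $\mathcal A$ be a $*$-algebra represented on $\mathcal H$ by bounded operators commuting with $\pi(H)$. Let $L\subset\mathcal H$ be a linear subspace such that for all $\psi,\varphi\in L$ the function $$\langle\psi,\varphi\rangle:\ h\mapsto(\pi(h)\varphi,\psi)$$ lies in $C_c(H)$. (a) If $L$ is mapped into itself by $\mathcal A$ and by all $\pi^-(f)$, $f\in C_c(H)$, then $\langle\cdot,\cdot\rangle$ is a rigging map on $L$ with values in $C_c(H)$: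 it is additive in each entry, and for all $\psi,\varphi\in L$, $\lambda,\mu\in\mathbb C$, $f\in C_c(H)$ and $A\in\mathcal A$: $\langle\lambda\psi,\mu\varphi\rangle=\overline\lambda\mu\langle\psi,\varphi\rangle$; $\langle\psi,\varphi\rangle^*=\langle\varphi,\psi\rangle$; $\langle\psi,\pi^-(f)\varphi\rangle=\langle\psi,\varphi\rangle*f$; $\langle A\psi,\varphi\rangle=\langle\psi,A^*\varphi\rangle$. (b) If $H$ is amenable, then $\langle\psi,\psi\rangle$ is a positive element of $C^*(H)$ for every $\psi\in L$. (c) Whether or not $H$ is amenable, every unitary representation $\sigma$ of $H$ on a Hilbert space that is weakly contained in the left regular representation on $L^2(H)$ is $L$-positive: $\sigma(\langle\psi,\psi\rangle)\ge 0$ as an operator for every $\psi\in L$. -/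

import Mathlib

open MeasureTheory
open scoped CompactlySupported ENNReal BoundedContinuousFunction

namespace Rigging

/-! ### Unitary representations -/

/-- A (strongly continuous) unitary representation of a topological group `H` on a complex
inner product space `K` (a Hilbert space in all uses). -/
structure UnitaryRep (H : Type*) [Group H] [TopologicalSpace H]
    (K : Type*) [NormedAddCommGroup K] [InnerProductSpace ℂ K] where
  /-- the homomorphism into the group of unitary operators -/
  toHom : H →* (K ≃ₗᵢ[ℂ] K)
  /-- strong continuity -/
  continuous_apply : ∀ v : K, Continuous fun h => toHom h v

/-- A unitary representation together with its Hilbert space. -/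
structure HilbertRep.{u} (H : Type u) [Group H] [TopologicalSpace H] where
  /-- the Hilbert space -/
  space : Type u
  [normed : NormedAddCommGroup space]
  [inner : InnerProductSpace ℂ space]
  [complete : CompleteSpace space]
  /-- the representation -/
  rep : UnitaryRep H space

attribute [instance] HilbertRep.normed HilbertRep.inner HilbertRep.complete

section Integrated

variable {H : Type*} [TopologicalSpace H] [MeasurableSpace H] [BorelSpace H]
  {K : Type*} [NormedAddCommGroup K] [InnerProductSpace ℂ K]

theorem integrable_smul (μ : Measure H) [IsFiniteMeasureOnCompacts μ] (f : C_c(H, ℂ))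
    {F : H → K} (hF : Continuous F) : Integrable (fun h => f h • F h) μ :=
  (f.continuous.smul hF).integrable_of_hasCompactSupport f.hasCompactSupport.smul_right

/-- The bounded operator `∫ f(h) T(h) dμ(h)`, for `f ∈ C_c(H)` and a strongly continuous family
`T` of unitaries; the integral is taken strongly, `v ↦ ∫ f(h) T(h) v dμ(h)`. -/
noncomputable def opIntegral (μ : Measure H) [IsFiniteMeasureOnCompacts μ] (f : C_c(H, ℂ))
    (T : H → (K ≃ₗᵢ[ℂ] K)) (hT : ∀ v : K, Continuous fun h => T h v) : K →L[ℂ] K :=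
  LinearMap.mkContinuous
    { toFun := fun v => ∫ h, f h • T h v ∂μ
      map_add' := fun v w => by
        simp only [map_add, smul_add]
        exact integral_add (integrable_smul μ f (hT v)) (integrable_smul μ f (hT w))
      map_smul' := fun c v => by
        simp only [map_smul, RingHom.id_apply]
        rw [← integral_smul]
        congr 1
        funext h
        exact smul_comm _ _ _ }
    (∫ h, ‖f h‖ ∂μ)
    (fun v => by
      refine (norm_integral_le_integral_norm _).trans (le_of_eq ?_)
      simp only [norm_smul, LinearIsometryEquiv.norm_map]
      exact integral_mul_const _ _)

theorem opIntegral_apply (μ : Measure H) [IsFiniteMeasureOnCompacts μ] (f : C_c(H, ℂ))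
    (T : H → (K ≃ₗᵢ[ℂ] K)) (hT : ∀ v : K, Continuous fun h => T h v) (v : K) :
    opIntegral μ f T hT v = ∫ h, f h • T h v ∂μ := rfl

theorem norm_opIntegral_le (μ : Measure H) [IsFiniteMeasureOnCompacts μ] (f : C_c(H, ℂ))
    (T : H → (K ≃ₗᵢ[ℂ] K)) (hT : ∀ v : K, Continuous fun h => T h v) :
    ‖opIntegral μ f T hT‖ ≤ ∫ h, ‖f h‖ ∂μ :=
  LinearMap.mkContinuous_norm_le _ (integral_nonneg fun _ => norm_nonneg _) _

end Integrated

section Group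

variable {H : Type*} [Group H] [TopologicalSpace H] [IsTopologicalGroup H]
  [MeasurableSpace H] [BorelSpace H]
  {K : Type*} [NormedAddCommGroup K] [InnerProductSpace ℂ K]

/-- The integrated form `π(f) = ∫ f(h) π(h) dh`. -/
noncomputable def UnitaryRep.integrated (π : UnitaryRep H K) (μ : Measure H)
    [IsFiniteMeasureOnCompacts μ] (f : C_c(H, ℂ)) : K →L[ℂ] K :=
  opIntegral μ f π.toHom π.continuous_apply

/-- The right action `π⁻(f) = ∫ f(h) π(h⁻¹) dh`. -/
noncomputable def UnitaryRep.integratedInv (π : UnitaryRep H K) (μ : Measure H)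
    [IsFiniteMeasureOnCompacts μ] (f : C_c(H, ℂ)) : K →L[ℂ] K :=
  opIntegral μ f (fun h => π.toHom h⁻¹) (fun v => (π.continuous_apply v).comp continuous_inv)

/-! ### The convolution `*`-algebra operations on `C_c(H)` (unimodular case) -/

/-- Convolution, `(f * g)(k) = ∫ f(h) g(h⁻¹ k) dh`. -/
noncomputable def conv (μ : Measure H) [IsFiniteMeasureOnCompacts μ] (f g : C_c(H, ℂ)) :
    C_c(H, ℂ) where
  toFun k := ∫ h, f h * g (h⁻¹ * k) ∂μ
  continuous_toFun := by
    rw [← continuousOn_univ]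
    refine continuousOn_integral_of_compact_support (k := tsupport f)
      f.hasCompactSupport ?_ ?_
    · exact Continuous.continuousOn (by
        simp only [Function.uncurry_def]
        exact (f.continuous.comp continuous_snd).mul
          (g.continuous.comp (continuous_snd.inv.mul continuous_fst)))
    · intro p x _ hx
      rw [image_eq_zero_of_notMem_tsupport hx, zero_mul]
  hasCompactSupport' := by
    refine HasCompactSupport.of_support_subset_isCompact
      (f.hasCompactSupport.isCompact.mul g.hasCompactSupport.isCompact) ?_
    intro k hk
    by_contra hcon
    refine hk ?_
    have : (fun h => f h * g (h⁻¹ * k)) = 0 := by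
      funext h
      by_cases hf : h ∈ tsupport f
      · have hg : h⁻¹ * k ∉ tsupport g := fun hg =>
          hcon ⟨h, hf, h⁻¹ * k, hg, mul_inv_cancel_left h k⟩
        simp [image_eq_zero_of_notMem_tsupport hg]
      · simp [image_eq_zero_of_notMem_tsupport hf]
    simp [this]

/-- The involution `f*(h) = conj f(h⁻¹)`. -/
noncomputable def invol (f : C_c(H, ℂ)) : C_c(H, ℂ) where
  toFun h := star (f h⁻¹)
  continuous_toFun := (f.continuous.comp continuous_inv).star
  hasCompactSupport' :=
    (f.hasCompactSupport.comp_homeomorph (Homeomorph.inv H)).comp_left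
      (g := fun z : ℂ => star z) (star_zero _)

/-! ### The rigging map -/

/-- The function `h ↦ (π(h) φ, ψ)` as an element of `C_c(H)`; Mathlib's `inner` is linear in the
second entry. Continuity is automatic. -/
noncomputable def riggingMap (π : UnitaryRep H K) (L : Submodule ℂ K)
    (hL : ∀ ψ φ : L, HasCompactSupport fun h => inner ℂ (ψ : K) (π.toHom h (φ : K)))
    (ψ φ : L) : C_c(H, ℂ) where
  toFun h := inner ℂ (ψ : K) (π.toHom h (φ : K))
  continuous_toFun := continuous_const.inner (π.continuous_apply φ)
  hasCompactSupport' := hL ψ φ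

/-- A `C_c(H)`-valued map `R` on `L × L` is a rigging map with respect to a right action of the
convolution `*`-algebra `C_c(H)` and a left action of a `*`-algebra `𝒜` on `L`. -/
structure IsRiggingMap {L : Type*} [AddCommGroup L] [Module ℂ L] {𝒜 : Type*} [Star 𝒜]
    (μ : Measure H) [IsFiniteMeasureOnCompacts μ]
    (rightAct : L → C_c(H, ℂ) → L) (leftAct : 𝒜 → L → L)
    (R : L → L → C_c(H, ℂ)) : Prop where
  add_left : ∀ ψ₁ ψ₂ φ : L, R (ψ₁ + ψ₂) φ = R ψ₁ φ + R ψ₂ φ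
  add_right : ∀ ψ φ₁ φ₂ : L, R ψ (φ₁ + φ₂) = R ψ φ₁ + R ψ φ₂
  smul_smul : ∀ (a b : ℂ) (ψ φ : L), R (a • ψ) (b • φ) = (star a * b) • R ψ φ
  invol_eq : ∀ ψ φ : L, invol (R ψ φ) = R φ ψ
  right_act : ∀ (ψ φ : L) (f : C_c(H, ℂ)), R ψ (rightAct φ f) = conv μ (R ψ φ) f
  left_act : ∀ (A : 𝒜) (ψ φ : L), R (leftAct A ψ) φ = R ψ (leftAct (star A) φ)

/-- A unitary representation `σ` is positive for a `C_c(H)`-valued map `R` on `L × L` if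
`σ(R(ψ, ψ)) ≥ 0` as an operator, for all `ψ ∈ L`. -/
def IsLPositive {L : Type*} (σ : UnitaryRep H K) (μ : Measure H) [IsFiniteMeasureOnCompacts μ]
    (R : L → L → C_c(H, ℂ)) : Prop :=
  ∀ ψ : L, (σ.integrated μ (R ψ ψ)).IsPositive

end Group

/-! ### The group `C*`-algebra -/

section CStar

universe u

variable {H : Type u} [Group H] [TopologicalSpace H] [IsTopologicalGroup H]
  [MeasurableSpace H] [BorelSpace H]

/-- The universal representation of `C_c(H)`: the family of all `π(f)`, where `π` runs through all
unitary representations of `H` (on Hilbert spaces in the universe of `H`, which contains all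
cyclic representations up to equivalence), as an element of the `ℓ^∞`-product of the `B(K_π)`. -/
noncomputable def universalRep (μ : Measure H) [IsFiniteMeasureOnCompacts μ] (f : C_c(H, ℂ)) :
    lp (fun i : HilbertRep.{u} H => i.space →L[ℂ] i.space) ∞ :=
  ⟨fun i => i.rep.integrated μ f, memℓp_infty ⟨∫ h, ‖f h‖ ∂μ, by
    rintro _ ⟨i, rfl⟩
    exact norm_opIntegral_le _ _ _ _⟩⟩

/-- The group `C*`-algebra `C*(H)`: the closed `*`-subalgebra generated by `C_c(H)` in its
universal representation, that is, the completion of `C_c(H)` in the norm `sup_π ‖π(f)‖`. -/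
noncomputable def groupCStar (μ : Measure H) [IsFiniteMeasureOnCompacts μ] :
    NonUnitalStarSubalgebra ℂ (lp (fun i : HilbertRep.{u} H => i.space →L[ℂ] i.space) ∞) :=
  (NonUnitalStarAlgebra.adjoin ℂ (Set.range (universalRep μ))).topologicalClosure

/-- The canonical map from `C_c(H)` to `C*(H)`. -/
noncomputable def toGroupCStar (μ : Measure H) [IsFiniteMeasureOnCompacts μ] (f : C_c(H, ℂ)) :
    groupCStar μ :=
  ⟨universalRep μ f, NonUnitalStarSubalgebra.le_topologicalClosure _
    (NonUnitalStarAlgebra.subset_adjoin ℂ _ ⟨f, rfl⟩)⟩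

/-- `f ∈ C_c(H)` is positive in `C*(H)`: there is `b` in `C*(H)` with `f = b* b`. -/
def IsPositiveInGroupCStar (μ : Measure H) [IsFiniteMeasureOnCompacts μ] (f : C_c(H, ℂ)) : Prop :=
  ∃ b : groupCStar μ, toGroupCStar μ f = star b * b

end CStar

/-! ### Amenability, the regular representation and weak containment -/

/-- A topological group is amenable if there is a left invariant mean on the bounded continuous
functions. -/
def IsAmenable (H : Type*) [Group H] [TopologicalSpace H] [IsTopologicalGroup H] : Prop :=
  ∃ m : (H →ᵇ ℝ) →ₗ[ℝ] ℝ,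
    (∀ f : H →ᵇ ℝ, (∀ x, 0 ≤ f x) → 0 ≤ m f) ∧
    m (BoundedContinuousFunction.const H 1) = 1 ∧
    ∀ (h : H) (f : H →ᵇ ℝ), m (f.compContinuous (ContinuousMap.mulLeft h)) = m f

section Regular

variable {H : Type*} [Group H] [TopologicalSpace H] [IsTopologicalGroup H]
  [LocallyCompactSpace H] [MeasurableSpace H] [BorelSpace H]

/-- The left regular representation on `L²(H)`, `(λ(h) ξ)(x) = ξ(h⁻¹ x)`. Mathlib's action of
`DomMulAct.mk c` on `L²(H)` is `ξ ↦ ξ(c ·)`. -/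
noncomputable def regularRep (μ : Measure H) [μ.IsHaarMeasure] [μ.Regular] :
    UnitaryRep H (Lp ℂ 2 μ) where
  toHom :=
    { toFun := fun h =>
        { toFun := fun ξ => DomMulAct.mk h⁻¹ • ξ
          invFun := fun ξ => DomMulAct.mk h • ξ
          left_inv := fun ξ => by
            simp [smul_smul]
          right_inv := fun ξ => by
            simp [smul_smul]
          map_add' := fun ξ η => smul_add _ _ _
          map_smul' := fun c ξ => smul_comm _ _ _
          norm_map' := fun ξ => DomMulAct.norm_smul_Lp _ _ }
      map_one' := by
        ext1 ξ
        change DomMulAct.mk (1 : H)⁻¹ • ξ = ξ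
        simp
      map_mul' := fun g h => by
        ext1 ξ
        change DomMulAct.mk (g * h)⁻¹ • ξ = DomMulAct.mk g⁻¹ • DomMulAct.mk h⁻¹ • ξ
        rw [smul_smul, ← DomMulAct.mk_mul, mul_inv_rev] }
  continuous_apply := fun ξ => by
    have : Fact ((2 : ℝ≥0∞) ≠ ∞) := ⟨by simp⟩
    change Continuous fun h : H => DomMulAct.mk h⁻¹ • ξ
    exact (DomMulAct.continuous_mk.comp continuous_inv).smul continuous_const

end Regular

/-- Weak containment of `σ` in `τ`: every diagonal matrix coefficient of `σ` is, uniformly on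
compact sets, a limit of finite sums of diagonal matrix coefficients of `τ`. -/
def WeaklyContained {H : Type*} [Group H] [TopologicalSpace H]
    {K : Type*} [NormedAddCommGroup K] [InnerProductSpace ℂ K]
    {E : Type*} [NormedAddCommGroup E] [InnerProductSpace ℂ E]
    (σ : UnitaryRep H K) (τ : UnitaryRep H E) : Prop :=
  ∀ (v : K) (Q : Set H), IsCompact Q → ∀ ε : ℝ, 0 < ε →
    ∃ (n : ℕ) (η : Fin n → E), ∀ h ∈ Q,
      ‖inner ℂ v (σ.toHom h v) - ∑ j, inner ℂ (η j) (τ.toHom h (η j))‖ < ε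

end Rigging

open Rigging

namespace Rigging

open scoped ComplexOrder TensorProduct

/-! ### Matrix coefficients of integrated operators -/

section Integrated

variable {H : Type*} [TopologicalSpace H] [MeasurableSpace H] [BorelSpace H]
  {K : Type*} [NormedAddCommGroup K] [InnerProductSpace ℂ K] [CompleteSpace K]

/-! The diagonal function `F = ⟨ψ, ψ⟩` is of positive type: with `w x = π(x⁻¹) ψ` one has `F(x y⁻¹)
= inner (w x) (w y)`. For `η` in `C_c(H)`, Fubini and unimodularity then turn the quadratic form of
`λ(F)` at `η`, where `λ` is the regular representation, into `‖∫ η(y) w(y) dy‖² ≥ 0`; density of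
`C_c(H)` in `L²(H)` gives `λ(F) ≥ 0` (`inner_regularRep_integrated_nonneg`). Weak containment
approximates coefficients uniformly on the support of `F`, so positivity passes to `σ`; this is (c).

For (b), the product `F · (σ(·)v, v)` is again of positive type, by the tensor product of the two
representations. Amenability makes the trivial representation weakly contained in `λ`, so the
integral of this product, which is `(σ(F)v, v)`, is nonnegative for every `σ`. Square roots taken in
each representation then show positivity in `C*(H)`.

The weak containment comes from Reiter's condition. A left invariant mean takes on averages of a
bounded function a value that depends only on the integral of the weight (`exists_mean_average_eq`);
Hahn–Banach turns this into almost invariant vectors in `L¹` (`exists_almost_invariant`), and `k ↦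
√|k|` moves them to `L²`.

Part (a) is direct computation; only the convolution identity uses the Haar measure. -/

theorem inner_opIntegral (μ : Measure H) [IsFiniteMeasureOnCompacts μ] (f : C_c(H, ℂ))
    (T : H → (K ≃ₗᵢ[ℂ] K)) (hT : ∀ v : K, Continuous fun h => T h v) (v w : K) :
    inner ℂ v (opIntegral μ f T hT w) = ∫ h, f h * inner ℂ v (T h w) ∂μ := by
  rw [opIntegral_apply, ← innerSL_apply_apply ℂ,
    ← ContinuousLinearMap.integral_comp_comm _ (integrable_smul μ f (hT w))]
  simp

end Integrated

/-! ### Positivity under weak containment, and the rigging identities -/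

section Group

variable {H : Type*} [Group H] [TopologicalSpace H]
  {K : Type*} [NormedAddCommGroup K] [InnerProductSpace ℂ K]

theorem UnitaryRep.mul_apply (π : UnitaryRep H K) (g h : H) (v : K) :
    π.toHom (g * h) v = π.toHom g (π.toHom h v) := by
  rw [map_mul]
  rfl

theorem UnitaryRep.inner_apply_left (π : UnitaryRep H K) (h : H) (v w : K) :
    inner ℂ (π.toHom h v) w = inner ℂ v (π.toHom h⁻¹ w) := by
  rw [← LinearIsometryEquiv.inner_map_map (π.toHom h) v, ← π.mul_apply, mul_inv_cancel]
  simp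

variable [MeasurableSpace H] [BorelSpace H]

theorem UnitaryRep.inner_integrated [CompleteSpace K] (π : UnitaryRep H K) (μ : Measure H)
    [IsFiniteMeasureOnCompacts μ] (f : C_c(H, ℂ)) (v w : K) :
    inner ℂ v (π.integrated μ f w) = ∫ h, f h * inner ℂ v (π.toHom h w) ∂μ :=
  inner_opIntegral ..

theorem isPositive_of_inner_nonneg {T : K →L[ℂ] K} (hT : ∀ v, 0 ≤ inner ℂ v (T v)) :
    T.IsPositive := by
  rw [ContinuousLinearMap.isPositive_iff_complex]
  intro v
  have h := hT v
  rw [← inner_conj_symm, Complex.nonneg_iff] at h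
  simp only [Complex.conj_re, Complex.conj_im, zero_eq_neg] at h
  exact ⟨Complex.ext rfl (by simpa using h.2.symm), h.1⟩

/-- Positivity of an integrated operator passes to weakly contained representations. -/
theorem inner_integrated_nonneg_of_weaklyContained [CompleteSpace K]
    {μ : Measure H} [IsFiniteMeasureOnCompacts μ]
    {E : Type*} [NormedAddCommGroup E] [InnerProductSpace ℂ E] [CompleteSpace E]
    {σ : UnitaryRep H K} {τ : UnitaryRep H E} (hσ : WeaklyContained σ τ) {F : C_c(H, ℂ)}
    (hpos : ∀ ξ : E, 0 ≤ inner ℂ ξ (τ.integrated μ F ξ)) (v : K) :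
    0 ≤ inner ℂ v (σ.integrated μ F v) := by
  have hclosed : IsClosed {z : ℂ | 0 ≤ z} := isClosed_le continuous_const continuous_id
  refine hclosed.closure_subset (Metric.mem_closure_iff.2 fun ε hε => ?_)
  set C := ∫ h, ‖F h‖ ∂μ
  have hC : 0 ≤ C := integral_nonneg fun _ => norm_nonneg _
  -- The total error is at most `C * (ε / (C + 1)) < ε`; the `+ 1` covers `C = 0`.
  obtain ⟨n, η, hη⟩ := hσ v (tsupport F) F.hasCompactSupport (ε / (C + 1)) (by positivity)
  refine ⟨∑ j, inner ℂ (η j) (τ.integrated μ F (η j)),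
    Finset.sum_nonneg fun j _ => hpos _, ?_⟩
  have hcF : Integrable (fun h => ‖F h‖) μ :=
    (F.continuous.integrable_of_hasCompactSupport F.hasCompactSupport).norm
  have hτ (e : E) : Integrable (fun h => F h * inner ℂ e (τ.toHom h e)) μ :=
    integrable_smul μ F (continuous_const.inner (τ.continuous_apply e))
  have hσv : Integrable (fun h => F h * inner ℂ v (σ.toHom h v)) μ :=
    integrable_smul μ F (continuous_const.inner (σ.continuous_apply v))
  simp only [UnitaryRep.inner_integrated]
  rw [dist_eq_norm, ← integral_finsetSum _ fun j _ => hτ _,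
    ← integral_sub hσv (integrable_finsetSum _ fun j _ => hτ _)]
  calc _ ≤ ∫ h, ‖F h‖ * (ε / (C + 1)) ∂μ := by
        refine norm_integral_le_of_norm_le (hcF.mul_const _) (.of_forall fun h => ?_)
        rw [← Finset.mul_sum, ← mul_sub, norm_mul]
        by_cases hh : h ∈ tsupport F
        · exact mul_le_mul_of_nonneg_left (hη h hh).le (norm_nonneg _)
        · simp [image_eq_zero_of_notMem_tsupport hh]
    _ = C * (ε / (C + 1)) := integral_mul_const _ _
    _ < ε := by
        rw [mul_div_assoc', div_lt_iff₀ (by positivity)]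
        linarith

variable [IsTopologicalGroup H]

/-- Right invariance of `μ` makes `μ.inv` left invariant, hence `c • μ`. Inverting twice gives `c ^
2 = 1`, tested on a compact set of positive finite measure, so `c = 1`. -/
theorem isInvInvariant_of_isMulRightInvariant [LocallyCompactSpace H]
    (μ : Measure H) [μ.IsHaarMeasure] [μ.Regular] [μ.IsMulRightInvariant] :
    μ.IsInvInvariant := by
  constructor
  let c : ℝ≥0∞ := Measure.haarScalarFactor μ.inv μ
  have hc : μ.inv = c • μ := Measure.isMulLeftInvariant_eq_smul_of_regular μ.inv μ
  have μeq : μ = c ^ 2 • μ := by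
    have h : (μ.inv).inv = c ^ 2 • μ := by
      conv_lhs => rw [hc, Measure.inv_def, Measure.map_smul, ← Measure.inv_def, hc, smul_smul]
      rw [pow_two]
    rwa [Measure.inv_inv] at h
  have K : TopologicalSpace.PositiveCompacts H := Classical.arbitrary _
  have hK : c ^ 2 * μ K = 1 ^ 2 * μ K := by
    conv_rhs => rw [μeq]
    simp
  have : c ^ 2 = 1 ^ 2 :=
    (ENNReal.mul_left_inj (Measure.measure_pos_of_nonempty_interior _ K.interior_nonempty).ne'
          K.isCompact.measure_lt_top.ne).1 hK
  have : c = 1 := (ENNReal.pow_right_strictMono two_ne_zero).injective this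
  rw [hc, this, one_smul]

theorem isRiggingMap_riggingMap [LocallyCompactSpace H]
    (μ : Measure H) [μ.IsHaarMeasure] [μ.Regular] [μ.IsMulRightInvariant] [CompleteSpace K]
    (π : UnitaryRep H K) (L : Submodule ℂ K)
    (hL : ∀ ψ φ : L, HasCompactSupport fun h => inner ℂ (ψ : K) (π.toHom h (φ : K)))
    {𝒜 : Type*} [Star 𝒜] (ρ : 𝒜 → (K →L[ℂ] K)) (hstar : ∀ A, ρ (star A) = star (ρ A))
    (hρ : ∀ (A : 𝒜) (h : H) (φ : K), ρ A (π.toHom h φ) = π.toHom h (ρ A φ))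
    (hB : ∀ (φ : L) (f : C_c(H, ℂ)), π.integratedInv μ f (φ : K) ∈ L)
    (hA : ∀ (A : 𝒜) (φ : L), ρ A (φ : K) ∈ L) :
    IsRiggingMap μ (fun (φ : L) f => (⟨π.integratedInv μ f (φ : K), hB φ f⟩ : L))
      (fun A (φ : L) => (⟨ρ A (φ : K), hA A φ⟩ : L)) (riggingMap π L hL) where
  add_left ψ₁ ψ₂ φ := by
    ext h
    exact inner_add_left _ _ _
  add_right ψ φ₁ φ₂ := by
    ext h
    change inner ℂ (ψ : K) (π.toHom h ((φ₁ : K) + φ₂)) = _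
    rw [map_add, inner_add_right]
    rfl
  smul_smul a b ψ φ := by
    ext h
    change inner ℂ (a • (ψ : K)) (π.toHom h (b • (φ : K))) =
      (star a * b) * inner ℂ (ψ : K) (π.toHom h (φ : K))
    rw [map_smul, inner_smul_left, inner_smul_right, mul_assoc]
    rfl
  invol_eq ψ φ := by
    ext h
    change star (inner ℂ (ψ : K) (π.toHom h⁻¹ (φ : K))) = inner ℂ (φ : K) (π.toHom h (ψ : K))
    rw [← π.inner_apply_left]
    exact inner_conj_symm _ _
  right_act ψ φ f := by
    have := isInvInvariant_of_isMulRightInvariant μ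
    ext k
    change inner ℂ (ψ : K) (π.toHom k (π.integratedInv μ f (φ : K))) =
      ∫ h, inner ℂ (ψ : K) (π.toHom h (φ : K)) * f (h⁻¹ * k) ∂μ
    -- Substituting `k / h` for `h` in the convolution leaves `f h` as second factor and the
    -- coefficient at `k h⁻¹` as first.
    rw [← integral_div_left_eq_self _ μ k, ← inv_inv k, ← π.inner_apply_left,
      UnitaryRep.integratedInv, inner_opIntegral]
    refine integral_congr_ae (.of_forall fun h => ?_)
    simp only [π.inner_apply_left, inv_inv, div_eq_mul_inv, π.mul_apply, mul_inv_rev,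
      inv_mul_cancel_right]
    ring
  left_act A ψ φ := by
    ext h
    change inner ℂ (ρ A (ψ : K)) (π.toHom h (φ : K)) =
      inner ℂ (ψ : K) (π.toHom h (ρ (star A) (φ : K)))
    rw [← hρ, hstar, ContinuousLinearMap.star_eq_adjoint, ContinuousLinearMap.adjoint_inner_right]

end Group

/-! ### Density of `C_c` in `Lᵖ` -/

section Density

open Set

/-- Continuous functions with compact support are dense in `Lᵖ` of a regular measure on a locally
compact space. Mathlib's `MemLp.exists_hasCompactSupport_eLpNorm_sub_le` asks for normality. -/
theorem exists_hasCompactSupport_eLpNorm_sub_le {X E : Type*} [TopologicalSpace X] [R1Space X]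
    [LocallyCompactSpace X] [MeasurableSpace X] [BorelSpace X] [NormedAddCommGroup E]
    [NormedSpace ℝ E] {μ : Measure X} [μ.Regular] {p : ℝ≥0∞} (hp : p ≠ ∞) {f : X → E}
    (hf : MemLp f p μ) {ε : ℝ≥0∞} (hε : ε ≠ 0) :
    ∃ g : X → E, eLpNorm (f - g) p μ ≤ ε ∧ Continuous g ∧ HasCompactSupport g := by
  refine hf.induction_dense hp _ ?_ (fun f g hf hg => ⟨hf.1.add hg.1, hf.2.add hg.2⟩)
    (fun f hf => (hf.1.memLp_of_hasCompactSupport (p := p) hf.2).1) hε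
  intro c t ht htμ ε hε
  obtain ⟨η, ηpos, hη⟩ := exists_eLpNorm_indicator_le (μ := μ) hp c hε
  have hη2 : (η / 2 : ℝ≥0∞) ≠ 0 := by simpa using ηpos.ne'
  obtain ⟨s, st, s_compact, s_closed, μs⟩ :=
    ht.exists_isCompact_isClosed_sdiff_lt htμ.ne hη2
  obtain ⟨V, tV, V_open, -, hV⟩ := ht.exists_isOpen_sdiff_lt htμ.ne hη2
  obtain ⟨g, hgs, hgV, hgc, hg⟩ := exists_continuous_one_zero_of_isCompact s_compact
    V_open.isClosed_compl (disjoint_compl_right_iff_subset.2 (st.trans tV))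
  -- The error vanishes on `s` and off `V`, and elsewhere has norm at most `‖c‖`; `V \ s` has
  -- measure at most `η`.
  refine ⟨fun x => g x • c, (eLpNorm_mono fun x => ?_).trans (hη (V \ s) ?_), by fun_prop,
    hgc.smul_right⟩
  · by_cases hxs : x ∈ s
    · simp [hgs hxs, hxs, st hxs]
    · by_cases hxV : x ∈ V
      · have h0 := (hg x).1
        have h1 := (hg x).2
        rw [indicator_of_mem (show x ∈ V \ s from ⟨hxV, hxs⟩), Pi.sub_apply]
        by_cases hxt : x ∈ t
        · have : g x • c - c = (g x - 1) • c := by rw [sub_smul, one_smul]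
          rw [indicator_of_mem hxt, this, norm_smul]
          refine mul_le_of_le_one_left (norm_nonneg _) ?_
          rw [Real.norm_eq_abs, abs_le]
          constructor <;> linarith
        · rw [indicator_of_notMem hxt, sub_zero, norm_smul]
          refine mul_le_of_le_one_left (norm_nonneg _) ?_
          rw [Real.norm_eq_abs, abs_le]
          constructor <;> linarith
      · simp [hgV hxV, show x ∉ t from fun h => hxV (tV h)]
  · calc μ (V \ s) ≤ μ ((V \ t) ∪ (t \ s)) := measure_mono fun x hx =>
          (em (x ∈ t)).elim (fun h => .inr ⟨h, hx.2⟩) fun h => .inl ⟨hx.1, h⟩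
      _ ≤ η / 2 + η / 2 := (measure_union_le _ _).trans (add_le_add hV.le μs.le)
      _ = η := ENNReal.add_halves _

end Density

/-! ### Functions of positive type on the regular representation -/

section Regular

variable {H : Type*} [Group H] [TopologicalSpace H] [IsTopologicalGroup H]
  [LocallyCompactSpace H] [MeasurableSpace H] [BorelSpace H]
  (μ : Measure H) [μ.IsHaarMeasure] [μ.Regular]

theorem regularRep_coeFn (h : H) (ξ : Lp ℂ 2 μ) :
    (regularRep μ).toHom h ξ =ᵐ[μ] fun x => ξ (h⁻¹ * x) :=
  DomMulAct.smul_Lp_ae_eq _ _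

variable {μ} in
theorem inner_regularRep_toLp {η : H → ℂ} (hη : MemLp η 2 μ) (h : H) :
    inner ℂ (hη.toLp η) ((regularRep μ).toHom h (hη.toLp η)) =
      ∫ x, star (η x) * η (h⁻¹ * x) ∂μ := by
  have hη' := hη.comp_measurePreserving (measurePreserving_mul_left μ h⁻¹)
  have : (regularRep μ).toHom h (hη.toLp η) = hη'.toLp (η ∘ (h⁻¹ * ·)) := rfl
  rw [this, L2.inner_def]
  refine integral_congr_ae ?_
  filter_upwards [hη.coeFn_toLp, hη'.coeFn_toLp] with x h₁ h₂
  simp [h₁, h₂, mul_comm]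

/-- A compactly supported function of positive type acts on `L²` as a positive operator. -/
theorem inner_regularRep_integrated_nonneg [μ.IsMulRightInvariant]
    {W : Type*} [NormedAddCommGroup W] [InnerProductSpace ℂ W] [CompleteSpace W]
    (F : C_c(H, ℂ)) {w : H → W} (hw : Continuous w)
    (hF : ∀ x y, inner ℂ (w x) (w y) = F (x * y⁻¹)) (ξ : Lp ℂ 2 μ) :
    0 ≤ inner ℂ ξ ((regularRep μ).integrated μ F ξ) := by
  have hclosed : IsClosed {ξ : Lp ℂ 2 μ | 0 ≤ inner ℂ ξ ((regularRep μ).integrated μ F ξ)} :=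
    isClosed_le continuous_const (by fun_prop)
  suffices h : ∀ (η : H → ℂ) (_ : Continuous η) (_ : HasCompactSupport η) (hη : MemLp η 2 μ),
      hη.toLp η ∈ {ξ : Lp ℂ 2 μ | 0 ≤ inner ℂ ξ ((regularRep μ).integrated μ F ξ)} by
    refine hclosed.closure_subset (Metric.mem_closure_iff.2 fun ε hε => ?_)
    obtain ⟨η, hd, hηc, hηs⟩ := exists_hasCompactSupport_eLpNorm_sub_le
      (by simp) (Lp.memLp ξ) (ε := ENNReal.ofReal (ε / 2)) (by simpa using hε)
    have hη : MemLp η 2 μ := hηc.memLp_of_hasCompactSupport hηs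
    refine ⟨hη.toLp η, h η hηc hηs hη, ?_⟩
    rw [Lp.dist_def, eLpNorm_congr_ae (Filter.EventuallyEq.rfl.sub hη.coeFn_toLp)]
    exact (ENNReal.toReal_le_of_le_ofReal (by positivity) hd).trans_lt (by linarith)
  intro η hηc hηs hη
  have := isInvInvariant_of_isMulRightInvariant μ
  have hint : Integrable (fun y => η y • w y) μ :=
    (hηc.smul hw).integrable_of_hasCompactSupport hηs.smul_right
  set u : W := ∫ y, η y • w y ∂μ with hu
  have key : inner ℂ (hη.toLp η) ((regularRep μ).integrated μ F (hη.toLp η)) = inner ℂ u u := by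
    calc _ = ∫ h, ∫ x, F h * (star (η x) * η (h⁻¹ * x)) ∂μ ∂μ := by
          rw [UnitaryRep.inner_integrated]
          simp only [inner_regularRep_toLp hη, integral_const_mul]
      _ = ∫ x, ∫ h, F h * (star (η x) * η (h⁻¹ * x)) ∂μ ∂μ := by
          -- `H` need not be σ-compact, so the swap rests on compact support of the integrand.
          refine integral_integral_swap_of_hasCompactSupport ?_ ?_
          · have := F.continuous
            simp only [Function.uncurry_def]
            fun_prop
          · refine HasCompactSupport.of_support_subset_isCompact
              (F.hasCompactSupport.isCompact.prod hηs.isCompact) fun p hp => ?_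
            simp only [Function.mem_support, Function.uncurry, ne_eq, mul_eq_zero, not_or,
              star_eq_zero] at hp
            exact ⟨subset_tsupport _ hp.1, subset_tsupport _ hp.2.1⟩
      _ = ∫ x, inner ℂ (η x • w x) u ∂μ := by
          refine integral_congr_ae (.of_forall fun x => ?_)
          dsimp only
          -- With `h = x / y`, `F h` becomes `inner (w x) (w y)` and `η (h⁻¹ * x)` becomes `η y`.
          rw [← integral_div_left_eq_self _ μ x, ← innerSL_apply_apply ℂ, hu,
            ← ContinuousLinearMap.integral_comp_comm _ hint]
          refine integral_congr_ae (.of_forall fun y => ?_)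
          simp [hF, div_eq_mul_inv]
          ring
      _ = inner ℂ u u := by
          rw [← inner_conj_symm u u, ← innerSL_apply_apply ℂ u u]
          conv_rhs => rw [hu]
          rw [← ContinuousLinearMap.integral_comp_comm _ hint, ← integral_conj]
          simp only [innerSL_apply_apply, ← hu, inner_conj_symm]
  change 0 ≤ inner ℂ (hη.toLp η) ((regularRep μ).integrated μ F (hη.toLp η))
  rw [key, inner_self_eq_norm_sq_to_K]
  exact RCLike.ofReal_nonneg.2 (sq_nonneg ‖u‖) |>.trans_eq (by simp)

theorem riggingMap_isLPositive_of_weaklyContained [μ.IsMulRightInvariant]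
    {𝓗 : Type*} [NormedAddCommGroup 𝓗] [InnerProductSpace ℂ 𝓗] [CompleteSpace 𝓗]
    (π : UnitaryRep H 𝓗) (L : Submodule ℂ 𝓗)
    (hL : ∀ ψ φ : L, HasCompactSupport fun h => inner ℂ (ψ : 𝓗) (π.toHom h (φ : 𝓗)))
    {K : Type*} [NormedAddCommGroup K] [InnerProductSpace ℂ K] [CompleteSpace K]
    (σ : UnitaryRep H K) (hσ : WeaklyContained σ (regularRep μ)) :
    IsLPositive σ μ (riggingMap π L hL) := fun ψ =>
  isPositive_of_inner_nonneg <| inner_integrated_nonneg_of_weaklyContained hσ <|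
    inner_regularRep_integrated_nonneg μ _ (w := fun x => π.toHom x⁻¹ (ψ : 𝓗))
      ((π.continuous_apply _).comp continuous_inv) fun x y => by
        simp only [π.inner_apply_left, inv_inv, ← π.mul_apply]
        rfl

end Regular

/-! ### Averages of bounded continuous functions -/

theorem integrable_coe {X : Type*} [TopologicalSpace X] [MeasurableSpace X]
    [BorelSpace X] (μ : Measure X) [IsFiniteMeasureOnCompacts μ] (f : C_c(X, ℝ)) :
    Integrable (fun t => f t) μ :=
  f.continuous.integrable_of_hasCompactSupport f.hasCompactSupport

section Average

variable {H : Type*} [Group H] [TopologicalSpace H] [IsTopologicalGroup H]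
  [MeasurableSpace H] [BorelSpace H]

/-- The average `x ↦ ∫ f(t) c(t x) dt` of left translates of `c`. -/
noncomputable def average (μ : Measure H) [IsFiniteMeasureOnCompacts μ] (f : C_c(H, ℝ))
    (c : H →ᵇ ℝ) : H →ᵇ ℝ :=
  BoundedContinuousFunction.ofNormedAddCommGroup (fun x => ∫ t, f t * c (t * x) ∂μ)
    (by
      rw [← continuousOn_univ]
      refine continuousOn_integral_of_compact_support (k := tsupport f)
        f.hasCompactSupport ?_ ?_
      · have := f.continuous
        have := c.continuous
        simp only [Function.uncurry_def]
        fun_prop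
      · intro p x _ hx
        rw [image_eq_zero_of_notMem_tsupport hx, zero_mul])
    (∫ t, ‖f t‖ * ‖c‖ ∂μ)
    (fun x => norm_integral_le_of_norm_le
      ((f.continuous.integrable_of_hasCompactSupport f.hasCompactSupport).norm.mul_const _)
      (.of_forall fun t => by
        rw [norm_mul]
        exact mul_le_mul_of_nonneg_left (c.norm_coe_le_norm _) (norm_nonneg _)))

variable (μ : Measure H) [IsFiniteMeasureOnCompacts μ]

theorem average_apply (f : C_c(H, ℝ)) (c : H →ᵇ ℝ) (x : H) :
    average μ f c x = ∫ t, f t * c (t * x) ∂μ := rfl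

theorem integrable_mul_translate (f : C_c(H, ℝ)) (c : H →ᵇ ℝ) (x : H) :
    Integrable (fun t => f t * c (t * x)) μ := by
  have := f.continuous
  have := c.continuous
  exact Continuous.integrable_of_hasCompactSupport (by fun_prop) f.hasCompactSupport.mul_right

theorem average_add_left (f g : C_c(H, ℝ)) (c : H →ᵇ ℝ) :
    average μ (f + g) c = average μ f c + average μ g c := by
  ext x
  simp only [average_apply, BoundedContinuousFunction.coe_add, Pi.add_apply,
    CompactlySupportedContinuousMap.coe_add, add_mul]
  exact integral_add (integrable_mul_translate μ f c x) (integrable_mul_translate μ g c x)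

theorem average_smul_left (a : ℝ) (f : C_c(H, ℝ)) (c : H →ᵇ ℝ) :
    average μ (a • f) c = a • average μ f c := by
  ext x
  simp only [average_apply, BoundedContinuousFunction.coe_smul,
    CompactlySupportedContinuousMap.coe_smul, Pi.smul_apply, smul_eq_mul, mul_assoc]
  exact integral_const_mul _ _

theorem average_add_const (f : C_c(H, ℝ)) (c : H →ᵇ ℝ) (a : ℝ) :
    average μ f (c + a • BoundedContinuousFunction.const H 1) =
      average μ f c + (a * ∫ t, f t ∂μ) • BoundedContinuousFunction.const H 1 := by
  ext x
  have := integral_add (integrable_mul_translate μ f c x)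
    ((integrable_coe μ f).mul_const a)
  simp only [average_apply, BoundedContinuousFunction.coe_add, Pi.add_apply,
    BoundedContinuousFunction.coe_smul, BoundedContinuousFunction.const_apply, smul_eq_mul,
    mul_one, mul_add, this, integral_mul_const]
  ring

/-- Precomposition of a compactly supported function with a homeomorphism. -/
noncomputable def compHomeo (f : C_c(H, ℝ)) (e : H ≃ₜ H) : C_c(H, ℝ) where
  toFun x := f (e x)
  continuous_toFun := f.continuous.comp e.continuous
  hasCompactSupport' := f.hasCompactSupport.comp_homeomorph e

/-- Right translation of the weight becomes left translation of the average, which a left invariant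
mean does not see. -/
theorem average_compHomeo_mulRight [μ.IsMulRightInvariant] (f : C_c(H, ℝ)) (c : H →ᵇ ℝ) (s : H) :
    average μ (compHomeo f (Homeomorph.mulRight s)) c =
      (average μ f c).compContinuous (ContinuousMap.mulLeft s⁻¹) := by
  ext x
  change ∫ t, f (t * s) * c (t * x) ∂μ = ∫ t, f t * c (t * (s⁻¹ * x)) ∂μ
  rw [← integral_mul_right_eq_self (fun t => f t * c (t * (s⁻¹ * x))) s]
  simp [mul_assoc]

end Average

/-! ### Invariant means and almost invariant vectors -/

section ApproximateFixedPoints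

open Filter Topology

variable {H : Type*} [Group H] [TopologicalSpace H] [IsTopologicalGroup H]
  [LocallyCompactSpace H] [MeasurableSpace H] [BorelSpace H]

/-- Averages of a bounded continuous function against `f` have mean proportional to `∫ f`: left
invariant means are topologically left invariant on averages. -/
theorem exists_mean_average_eq [T2Space H]
    (μ : Measure H) [μ.IsHaarMeasure] [μ.Regular] [μ.IsMulRightInvariant]
    {m : (H →ᵇ ℝ) →ₗ[ℝ] ℝ} (hpos : ∀ f : H →ᵇ ℝ, (∀ x, 0 ≤ f x) → 0 ≤ m f)
    (hone : m (BoundedContinuousFunction.const H 1) = 1)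
    (hinv : ∀ (h : H) (f : H →ᵇ ℝ), m (f.compContinuous (ContinuousMap.mulLeft h)) = m f)
    (c : H →ᵇ ℝ) : ∃ C : ℝ, ∀ f : C_c(H, ℝ), m (average μ f c) = C * ∫ t, f t ∂μ := by
  -- Adding the constant `‖c‖` makes `c` nonnegative, so that `f ↦ m (average μ f c)` is a positive
  -- functional and is given by a measure `ν`.
  wlog hc : ∀ x, 0 ≤ c x generalizing c
  · obtain ⟨C, hC⟩ := this (c + ‖c‖ • BoundedContinuousFunction.const H 1) fun x => by
      have := neg_le_of_abs_le (c.norm_coe_le_norm x)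
      simp only [BoundedContinuousFunction.coe_add, Pi.add_apply,
        BoundedContinuousFunction.coe_smul, BoundedContinuousFunction.const_apply, smul_eq_mul]
      linarith
    refine ⟨C - ‖c‖, fun f => ?_⟩
    have := hC f
    rw [average_add_const, map_add, map_smul, hone, smul_eq_mul] at this
    linarith
  let Λ₀ : C_c(H, ℝ) →ₗ[ℝ] ℝ :=
    { toFun := fun f => m (average μ f c)
      map_add' := fun f g => by rw [average_add_left, map_add]
      map_smul' := fun a f => by rw [average_smul_left, map_smul]; rfl }
  let Λ : C_c(H, ℝ) →ₚ[ℝ] ℝ := PositiveLinearMap.mk₀ Λ₀ fun f hf =>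
    hpos _ fun x => integral_nonneg fun t => mul_nonneg (hf t) (hc _)
  let ν := RealRMK.rieszMeasure Λ
  have hν (f : C_c(H, ℝ)) : ∫ x, f x ∂ν = m (average μ f c) := RealRMK.integral_rieszMeasure Λ f
  have : ν.Regular := RealRMK.regular_rieszMeasure Λ
  have : ν.IsMulRightInvariant := by
    refine ⟨fun s => ?_⟩
    have : (ν.map (· * s)).Regular := Measure.Regular.map (Homeomorph.mulRight s)
    refine Measure.ext_of_integral_eq_on_compactlySupported fun f => ?_
    have hmap := integral_map (μ := ν) (measurable_mul_const s).aemeasurable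
      (f := fun t => f t) (f.continuous.aestronglyMeasurable)
    rw [hmap]
    have := hν (compHomeo f (Homeomorph.mulRight s))
    rw [average_compHomeo_mulRight, hinv, ← hν] at this
    exact this
  have := isInvInvariant_of_isMulRightInvariant μ
  -- `ν` is right invariant, so `ν.inv` is left invariant and a multiple of `μ`; inversion
  -- invariance of `μ` brings the identity back to `ν`.
  refine ⟨Measure.haarScalarFactor ν.inv μ, fun f => ?_⟩
  have hmap := integral_map (μ := ν) measurable_inv.aemeasurable
    (f := fun t => f t⁻¹) (f.continuous.comp continuous_inv).aestronglyMeasurable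
  have key := Measure.integral_isMulLeftInvariant_eq_smul_of_hasCompactSupport ν.inv μ
    (f := fun t => f t⁻¹) (f.continuous.comp continuous_inv)
    (f.hasCompactSupport.comp_homeomorph (Homeomorph.inv H))
  rw [integral_smul_nnreal_measure, integral_inv_eq_self (fun x => f x) μ] at key
  simp only [inv_inv] at hmap
  rw [← hν, ← hmap]
  exact key

/-- This is continuity of left translation in `L¹`, at the class of `f`. -/
theorem tendsto_integral_translate_sub (μ : Measure H) [μ.IsHaarMeasure] [μ.Regular]
    (f : C_c(H, ℝ)) : Tendsto (fun h => ∫ t, ‖f (h⁻¹ * t) - f t‖ ∂μ) (𝓝 1) (𝓝 0) := by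
  have hf : MemLp f 1 μ := f.continuous.memLp_of_hasCompactSupport f.hasCompactSupport
  have : Fact ((1 : ℝ≥0∞) ≠ ∞) := ⟨by simp⟩
  have hcont : Continuous fun h : H => ‖DomMulAct.mk h⁻¹ • hf.toLp f - hf.toLp f‖ :=
    (((DomMulAct.continuous_mk.comp continuous_inv).smul continuous_const).sub
      continuous_const).norm
  have h1 := hcont.tendsto 1
  simp only [inv_one, DomMulAct.mk_one, one_smul, sub_self, norm_zero] at h1
  refine h1.congr fun h => ?_
  have hf' := hf.comp_measurePreserving (measurePreserving_mul_left μ h⁻¹)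
  change ‖hf'.toLp (f ∘ (h⁻¹ * ·)) - hf.toLp f‖ = _
  rw [← MemLp.toLp_sub, L1.norm_eq_integral_norm]
  refine integral_congr_ae ?_
  filter_upwards [(hf'.sub hf).coeFn_toLp] with x hx
  rw [hx]
  rfl

/-- An isometric action of an amenable group has almost invariant vectors in each hyperplane
`χ = 1` of an invariant functional `χ ≠ 0`. -/
theorem exists_almost_invariant [T2Space H]
    (μ : Measure H) [μ.IsHaarMeasure] [μ.Regular] [μ.IsMulRightInvariant]
    {E : Type*} [NormedAddCommGroup E] [NormedSpace ℝ E] [CompleteSpace E] (hH : IsAmenable H) (T : H →* (E ≃ₗᵢ[ℝ] E))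
    (hT : ∀ v, Continuous fun h => T h v) (χ : E →L[ℝ] ℝ) (hχ : ∀ h v, χ (T h v) = χ v)
    {v : E} (hv : χ v = 1) {Q : Set H} (hQ : IsCompact Q) {ε : ℝ} (hε : 0 < ε) :
    ∃ k : E, χ k = 1 ∧ ∀ h ∈ Q, ‖T h k - k‖ < ε := by
  obtain ⟨m, hpos, hone, hinv⟩ := hH
  have hTmul (g h : H) (w : E) : T (g * h) w = T g (T h w) := by rw [map_mul]; rfl
  obtain ⟨f, hf⟩ : ∃ f : C_c(H, ℝ), ∫ t, f t ∂μ = 1 := by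
    obtain ⟨g, hgc, hg0, hg1⟩ := exists_continuous_nonneg_pos (1 : H)
    have hg := g.continuous.integral_pos_of_hasCompactSupport_nonneg_nonzero (μ := μ) hgc hg0 hg1
    refine ⟨(∫ t, g t ∂μ)⁻¹ • ⟨g, hgc⟩, ?_⟩
    change ∫ t, (∫ t, g t ∂μ)⁻¹ * g t ∂μ = 1
    rw [integral_const_mul, inv_mul_cancel₀ hg.ne']
  have hint (g : C_c(H, ℝ)) (x : H) : Integrable (fun t => g t • T (t * x) v) μ :=
    (g.continuous.smul ((hT v).comp (continuous_mul_const x))).integrable_of_hasCompactSupport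
      g.hasCompactSupport.smul_right
  let k (g : C_c(H, ℝ)) (x : H) : E := ∫ t, g t • T (t * x) v ∂μ
  let tr (h : H) : C_c(H, ℝ) := compHomeo f (Homeomorph.mulLeft h⁻¹)
  have hTk (h x : H) : T h (k f x) = k (tr h) x := by
    change (T h : E →L[ℝ] E) (∫ t, f t • T (t * x) v ∂μ) = ∫ t, f (h⁻¹ * t) • T (t * x) v ∂μ
    rw [← ContinuousLinearMap.integral_comp_comm _ (hint f x), ← integral_mul_left_eq_self (fun t => f (h⁻¹ * t) • _) h]
    simp [mul_assoc]
  have hχk (x : H) : χ (k f x) = 1 := by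
    rw [← ContinuousLinearMap.integral_comp_comm _ (hint f x)]
    simp [hχ, hv, hf]
  -- This modulus does not depend on `x`, so it survives convex combinations and later reduces the
  -- compact `Q` to a finite set.
  let ω (h : H) : ℝ := (∫ t, ‖f (h⁻¹ * t) - f t‖ ∂μ) * ‖v‖
  have hωk (h x : H) : ‖T h (k f x) - k f x‖ ≤ ω h := by
    rw [hTk, ← integral_sub (hint _ x) (hint _ x)]
    change _ ≤ (∫ t, ‖f (h⁻¹ * t) - f t‖ ∂μ) * ‖v‖
    rw [← integral_mul_const]
    refine norm_integral_le_of_norm_le ?_ (.of_forall fun t => ?_)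
    · have hi := ((tr h).continuous.integrable_of_hasCompactSupport (tr h).hasCompactSupport
        (μ := μ)).sub (f.continuous.integrable_of_hasCompactSupport f.hasCompactSupport)
      exact hi.norm.mul_const _
    · rw [← sub_smul, norm_smul, LinearIsometryEquiv.norm_map]
      rfl
  have hω0 : Tendsto ω (𝓝 1) (𝓝 0) := by
    simpa only [zero_mul] using (tendsto_integral_translate_sub μ f).mul_const ‖v‖
  have hhull {w : E} (hw : w ∈ convexHull ℝ (Set.range (k f))) :
      χ w = 1 ∧ ∀ h, ‖T h w - w‖ ≤ ω h := by
    refine ⟨convexHull_min (t := {w | χ w = 1}) ?_ (convex_hyperplane χ.isLinear 1) hw, fun h =>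
      ?_⟩
    · rintro _ ⟨x, rfl⟩
      exact hχk x
    · have := convexHull_min (t := ((T h : E →L[ℝ] E) - 1 : E →L[ℝ] E) ⁻¹' Metric.closedBall 0 (ω h))
        ?_ ((convex_closedBall 0 (ω h)).linear_preimage
          ((T h : E →L[ℝ] E) - 1 : E →L[ℝ] E).toLinearMap) hw
      · simpa using this
      · rintro _ ⟨x, rfl⟩
        simpa using hωk h x
  have hfin (S : Finset H) (δ : ℝ) (hδ : 0 < δ) :
      ∃ w ∈ convexHull ℝ (Set.range (k f)), ∀ s ∈ S, ‖T s w - w‖ < δ := by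
    classical
    let D : E →L[ℝ] (S → E) := ContinuousLinearMap.pi fun s => (T s : E →L[ℝ] E) - 1
    suffices h0 : (0 : S → E) ∈ closure (D '' convexHull ℝ (Set.range (k f))) by
      obtain ⟨_, ⟨w, hw, rfl⟩, hd⟩ := Metric.mem_closure_iff.1 h0 δ hδ
      refine ⟨w, hw, fun s hs => ?_⟩
      rw [dist_zero_left] at hd
      exact (norm_le_pi_norm (D w) ⟨s, hs⟩).trans_lt hd
    -- Separation gives `Φ (D (k f x)) > u > 0` for all `x`. As a function of `x` this is a sum of
    -- differences of averages with weights of equal integral, so its mean is `0`, yet it must be at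
    -- least `u`.
    by_contra h0
    obtain ⟨Φ, u, hu0, hu⟩ := geometric_hahn_banach_point_closed
      ((convex_convexHull ℝ _).linear_image D.toLinearMap).closure isClosed_closure h0
    rw [map_zero] at hu0
    let Φs (s : S) : E →L[ℝ] ℝ := Φ.comp (ContinuousLinearMap.single ℝ (fun _ : S => E) s)
    have hΦ (w : S → E) : Φ w = ∑ s, Φs s (w s) := by
      conv_lhs => rw [← Finset.univ_sum_single w, map_sum]
      rfl
    let c (s : S) : H →ᵇ ℝ := BoundedContinuousFunction.ofNormedAddCommGroup
      (fun x => Φs s (T x v)) ((Φs s).continuous.comp (hT v)) (‖Φs s‖ * ‖v‖) fun x => by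
        simpa using (Φs s).le_opNorm (T x v)
    have hc (s : S) (g : C_c(H, ℝ)) (x : H) : Φs s (k g x) = average μ g (c s) x := by
      rw [← ContinuousLinearMap.integral_comp_comm _ (hint g x), average_apply]
      simp [c]
    let b : H →ᵇ ℝ := ∑ s : S, (average μ (tr s) (c s) - average μ f (c s))
    have hb (x : H) : Φ (D (k f x)) = b x := by
      rw [hΦ]
      simp [b, D, hTk, hc]
    have hmb : m b = 0 := by
      rw [map_sum]
      refine Finset.sum_eq_zero fun s _ => ?_
      obtain ⟨C, hC⟩ := exists_mean_average_eq μ hpos hone hinv (c s)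
      rw [map_sub, hC, hC]
      change C * ∫ t, f ((s : H)⁻¹ * t) ∂μ - _ = 0
      rw [integral_mul_left_eq_self (fun t => f t), sub_self]
    have hle := hpos (b - u • BoundedContinuousFunction.const H 1) fun x => by
      have := hu _ (subset_closure ⟨k f x, subset_convexHull ℝ _ ⟨x, rfl⟩, rfl⟩)
      change u < Φ (D (k f x)) at this
      rw [hb] at this
      simpa using this.le
    rw [map_sub, map_smul, hone, hmb, smul_eq_mul] at hle
    linarith
  have hV : {g | ω g < ε / 2} ∈ 𝓝 (1 : H) := hω0 (Iio_mem_nhds (by positivity))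
  -- Write `h = s (s⁻¹ h)` with `s⁻¹ h` near `1`: `ω` controls the near factor and `hfin` the
  -- finitely many `s`.
  obtain ⟨S, -, hS⟩ := hQ.elim_nhds_subcover (fun s => (s⁻¹ * ·) ⁻¹' {g | ω g < ε / 2})
    fun s _ => (continuous_const_mul s⁻¹).continuousAt.preimage_mem_nhds (by simpa using hV)
  obtain ⟨w, hw, hwS⟩ := hfin S (ε / 2) (by positivity)
  refine ⟨w, (hhull hw).1, fun h hh => ?_⟩
  obtain ⟨s, hs, hsh⟩ := Set.mem_iUnion₂.1 (hS hh)
  calc ‖T h w - w‖ = ‖T s (T (s⁻¹ * h) w - w) + (T s w - w)‖ := by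
        rw [map_sub, ← hTmul, mul_inv_cancel_left, sub_add_sub_cancel]
    _ ≤ ‖T (s⁻¹ * h) w - w‖ + ‖T s w - w‖ :=
        (norm_add_le _ _).trans_eq (by rw [LinearIsometryEquiv.norm_map])
    _ < ε / 2 + ε / 2 := add_lt_add (((hhull hw).2 _).trans_lt hsh) (hwS s hs)
    _ = ε := add_halves ε

end ApproximateFixedPoints

/-! ### The trivial representation -/

section TrivialRep

variable (H : Type*) [Group H] [TopologicalSpace H]

/-- The trivial representation on `ℂ`. -/
noncomputable def trivialRep : UnitaryRep H ℂ where
  toHom := 1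
  continuous_apply _ := continuous_const

theorem trivialRep_apply (h : H) (z : ℂ) : (trivialRep H).toHom h z = z := rfl

end TrivialRep

/-! ### Reiter's condition and positivity over amenable groups -/

section Amenable

variable {H : Type*} [Group H] [TopologicalSpace H] [IsTopologicalGroup H]
  [MeasurableSpace H] [BorelSpace H]

/-- Left translation on `L¹(H, ℝ)`. -/
noncomputable def translateL1 (μ : Measure H) [μ.IsHaarMeasure] :
    H →* (Lp ℝ 1 μ ≃ₗᵢ[ℝ] Lp ℝ 1 μ) where
  toFun h :=
    { toFun := fun ξ => DomMulAct.mk h⁻¹ • ξ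
      invFun := fun ξ => DomMulAct.mk h • ξ
      left_inv := fun ξ => by simp [smul_smul]
      right_inv := fun ξ => by simp [smul_smul]
      map_add' := fun ξ η => smul_add _ _ _
      map_smul' := fun c ξ => smul_comm _ _ _
      norm_map' := fun ξ => DomMulAct.norm_smul_Lp _ _ }
  map_one' := by
    ext1 ξ
    change DomMulAct.mk (1 : H)⁻¹ • ξ = ξ
    simp
  map_mul' g h := by
    ext1 ξ
    change DomMulAct.mk (g * h)⁻¹ • ξ = DomMulAct.mk g⁻¹ • DomMulAct.mk h⁻¹ • ξ
    rw [smul_smul, ← DomMulAct.mk_mul, mul_inv_rev]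

theorem translateL1_coeFn (μ : Measure H) [μ.IsHaarMeasure] (h : H) (k : Lp ℝ 1 μ) :
    translateL1 μ h k =ᵐ[μ] fun x => k (h⁻¹ * x) :=
  DomMulAct.smul_Lp_ae_eq _ _

variable [LocallyCompactSpace H]

theorem continuous_translateL1 (μ : Measure H) [μ.IsHaarMeasure] [μ.Regular] (k : Lp ℝ 1 μ) :
    Continuous fun h => translateL1 μ h k := by
  have : Fact ((1 : ℝ≥0∞) ≠ ∞) := ⟨by simp⟩
  change Continuous fun h : H => DomMulAct.mk h⁻¹ • k
  exact (DomMulAct.continuous_mk.comp continuous_inv).smul continuous_const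

/-- One factor `|√|a| - √|b||` is at most `√|a| + √|b|`, and the product is `||a| - |b||`. It bounds
squared `L²` distances by `L¹` distances. -/
theorem sq_sqrt_abs_sub_le (a b : ℝ) : (√|a| - √|b|) ^ 2 ≤ |a - b| := by
  have ha := Real.sq_sqrt (abs_nonneg a)
  have hb := Real.sq_sqrt (abs_nonneg b)
  have h1 := Real.sqrt_nonneg |a|
  have h2 := Real.sqrt_nonneg |b|
  have h3 := abs_sub_abs_le_abs_sub a b
  have h4 := abs_sub_abs_le_abs_sub b a
  rw [abs_sub_comm b a] at h4
  rcases le_total √|a| √|b| with h | h <;> nlinarith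

theorem L2_norm_sq_eq {X : Type*} [MeasurableSpace X] {μ : Measure X} (ξ : Lp ℂ 2 μ) :
    ‖ξ‖ ^ 2 = ∫ x, ‖ξ x‖ ^ 2 ∂μ := by
  have h := inner_self_eq_norm_sq_to_K (𝕜 := ℂ) ξ
  rw [L2.inner_def] at h
  simp only [inner_self_eq_norm_sq_to_K] at h
  have h' : ((∫ x, ‖ξ x‖ ^ 2 ∂μ : ℝ) : ℂ) = ((‖ξ‖ ^ 2 : ℝ) : ℂ) := by
    rw [← integral_complex_ofReal]
    simpa using h
  exact (Complex.ofReal_injective h').symm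

variable [T2Space H] (μ : Measure H) [μ.IsHaarMeasure] [μ.Regular] [μ.IsMulRightInvariant]

/-- Reiter's condition `(P₂)`. -/
theorem exists_almost_invariant_regularRep (hH : IsAmenable H) {Q : Set H} (hQ : IsCompact Q)
    {ε : ℝ} (hε : 0 < ε) :
    ∃ ξ : Lp ℂ 2 μ, 1 ≤ ‖ξ‖ ∧ ∀ h ∈ Q, ‖(regularRep μ).toHom h ξ - ξ‖ < ε := by
  obtain ⟨v, hv⟩ : ∃ v : Lp ℝ 1 μ, L1.integralCLM v = (1 : ℝ) := by
    obtain ⟨g, hgc, hg0, hg1⟩ := exists_continuous_nonneg_pos (1 : H)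
    have hg := g.continuous.integral_pos_of_hasCompactSupport_nonneg_nonzero (μ := μ) hgc hg0 hg1
    have hgi : Integrable g μ := g.continuous.integrable_of_hasCompactSupport hgc
    refine ⟨(∫ t, g t ∂μ)⁻¹ • hgi.toL1 g, ?_⟩
    rw [map_smul, ← L1.integral_eq, ← integral_eq _ hgi, smul_eq_mul, inv_mul_cancel₀ hg.ne']
  obtain ⟨k, hk1, hk⟩ := exists_almost_invariant μ hH (translateL1 μ) (continuous_translateL1 μ)
    (L1.integralCLM (α := H) (E := ℝ) (μ := μ)) (fun h w => by
      simp only [← L1.integral_eq, L1.integral_eq_integral]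
      rw [integral_congr_ae (translateL1_coeFn μ h w), integral_mul_left_eq_self (fun x => w x)])
    hv hQ (ε := ε ^ 2) (by positivity)
  have hki : Integrable k μ := L1.integrable_coeFn k
  have hmeas : AEStronglyMeasurable (fun x => ((√|k x| : ℝ) : ℂ)) μ :=
    (Complex.continuous_ofReal.comp (Real.continuous_sqrt.comp continuous_abs)
      ).comp_aestronglyMeasurable hki.1
  have hsq (x : H) : ‖((√|k x| : ℝ) : ℂ)‖ ^ 2 = ‖k x‖ := by
    rw [Complex.norm_real, Real.norm_eq_abs, sq_abs, Real.sq_sqrt (abs_nonneg _),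
      Real.norm_eq_abs]
  have hmem : MemLp (fun x => ((√|k x| : ℝ) : ℂ)) 2 μ := by
    rw [memLp_two_iff_integrable_sq_norm hmeas]
    simpa only [hsq] using hki.norm
  -- `k` is not known to be nonnegative, hence `√|k|`; its norm is at least `1` because `∫ |k| ≥ ∫ k
  -- = 1`.
  set ξ := hmem.toLp _ with hξdef
  have hξ : ξ =ᵐ[μ] fun x => ((√|k x| : ℝ) : ℂ) := hmem.coeFn_toLp
  refine ⟨ξ, ?_, fun h hh => ?_⟩
  · rw [← one_le_sq_iff₀ (norm_nonneg _), L2_norm_sq_eq,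
      integral_congr_ae (hξ.mono fun x hx => by rw [hx, hsq]), ← hk1, ← L1.integral_eq,
      L1.integral_eq_integral]
    exact (Real.le_norm_self _).trans (norm_integral_le_integral_norm _)
  · refine lt_of_pow_lt_pow_left₀ 2 hε.le (lt_of_le_of_lt ?_ (hk h hh))
    rw [L2_norm_sq_eq, L1.norm_eq_integral_norm]
    refine integral_mono_ae ?_ (L1.integrable_coeFn _).norm ?_
    · exact (memLp_two_iff_integrable_sq_norm (Lp.memLp _).1).1 (Lp.memLp _)
    · have hq := (measurePreserving_mul_left μ h⁻¹).quasiMeasurePreserving.ae_eq_comp hξ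
      filter_upwards [Lp.coeFn_sub ((regularRep μ).toHom h ξ) ξ, regularRep_coeFn μ h ξ, hξ, hq,
        Lp.coeFn_sub (translateL1 μ h k) k, translateL1_coeFn μ h k] with x h1 h2 h3 h4 h5 h6
      rw [h1, h5, Pi.sub_apply, Pi.sub_apply, h2, h3, h6]
      simp only [Function.comp_apply] at h4
      rw [h4, ← Complex.ofReal_sub, Complex.norm_real, Real.norm_eq_abs, sq_abs]
      exact sq_sqrt_abs_sub_le _ _

theorem trivialRep_weaklyContained_regularRep (hH : IsAmenable H) :
    WeaklyContained (trivialRep H) (regularRep μ) := by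
  intro v Q hQ ε hε
  obtain ⟨ξ, hξ1, hξ⟩ := exists_almost_invariant_regularRep μ hH hQ
    (ε := ε / (‖v‖ ^ 2 + 1)) (by positivity)
  have hξ0 : (‖ξ‖ : ℂ) ≠ 0 := by
    norm_cast
    linarith
  -- One vector of norm `‖v‖` suffices: the coefficients agree at the identity and differ elsewhere
  -- only by the displacement of `ξ`.
  refine ⟨1, fun _ => (v / ‖ξ‖) • ξ, fun h hh => ?_⟩
  have h1 : inner ℂ v ((trivialRep H).toHom h v) -
      ∑ _j : Fin 1, inner ℂ ((v / ‖ξ‖) • ξ) ((regularRep μ).toHom h ((v / ‖ξ‖) • ξ)) =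
      -((star (v / ‖ξ‖) * (v / ‖ξ‖)) * inner ℂ ξ ((regularRep μ).toHom h ξ - ξ)) := by
    rw [inner_sub_right, inner_self_eq_norm_sq_to_K, trivialRep_apply, RCLike.inner_apply]
    rw [Fin.sum_univ_one, map_smul, inner_smul_left, inner_smul_right, RCLike.star_def, map_div₀,
      Complex.conj_ofReal]
    simp only [Complex.coe_algebraMap]
    field_simp
    ring
  rw [h1, norm_neg, norm_mul, norm_mul, norm_star, norm_div, Complex.norm_real, norm_norm]
  have hξpos : 0 < ‖ξ‖ := by linarith
  calc ‖v‖ / ‖ξ‖ * (‖v‖ / ‖ξ‖) * ‖inner ℂ ξ ((regularRep μ).toHom h ξ - ξ)‖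
      ≤ ‖v‖ / ‖ξ‖ * (‖v‖ / ‖ξ‖) * (‖ξ‖ * (ε / (‖v‖ ^ 2 + 1))) := by
        gcongr
        exact (norm_inner_le_norm _ _).trans (by gcongr; exact (hξ h hh).le)
    _ = ‖v‖ ^ 2 / ‖ξ‖ * (ε / (‖v‖ ^ 2 + 1)) := by field_simp
    _ ≤ ‖v‖ ^ 2 * (ε / (‖v‖ ^ 2 + 1)) := by
        gcongr
        exact div_le_self (by positivity) hξ1
    _ < ε := by
        rw [mul_div_assoc', div_lt_iff₀ (by positivity)]
        linarith

/-- Over an amenable group every representation is positive for the rigging map. -/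
theorem riggingMap_isLPositive_of_isAmenable (hH : IsAmenable H)
    {𝓗 : Type*} [NormedAddCommGroup 𝓗] [InnerProductSpace ℂ 𝓗] [CompleteSpace 𝓗]
    (π : UnitaryRep H 𝓗) (L : Submodule ℂ 𝓗)
    (hL : ∀ ψ φ : L, HasCompactSupport fun h => inner ℂ (ψ : 𝓗) (π.toHom h (φ : 𝓗)))
    {K : Type*} [NormedAddCommGroup K] [InnerProductSpace ℂ K] [CompleteSpace K]
    (σ : UnitaryRep H K) : IsLPositive σ μ (riggingMap π L hL) := by
  refine fun ψ => isPositive_of_inner_nonneg fun v => ?_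
  let F : C_c(H, ℂ) :=
    { toFun := fun h => riggingMap π L hL ψ ψ h * inner ℂ v (σ.toHom h v)
      continuous_toFun := (riggingMap π L hL ψ ψ).continuous.mul
        (continuous_const.inner (σ.continuous_apply v))
      hasCompactSupport' := (riggingMap π L hL ψ ψ).hasCompactSupport.mul_right }
  -- Inner products of elementary tensors multiply, so `w` exhibits the product `F` as a function of
  -- positive type.
  let w (x : H) : UniformSpace.Completion (𝓗 ⊗[ℂ] K) :=
    ((π.toHom x⁻¹ (ψ : 𝓗) ⊗ₜ[ℂ] σ.toHom x⁻¹ v : 𝓗 ⊗[ℂ] K) :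
      UniformSpace.Completion (𝓗 ⊗[ℂ] K))
  have hw : Continuous w := by
    refine (UniformSpace.Completion.continuous_coe _).comp
      (TensorProduct.continuous_tmul.comp (Continuous.prodMk ?_ ?_))
    · exact (π.continuous_apply _).comp continuous_inv
    · exact (σ.continuous_apply _).comp continuous_inv
  have hF (x y : H) : inner ℂ (w x) (w y) = F (x * y⁻¹) := by
    simp only [w, UniformSpace.Completion.inner_coe, TensorProduct.inner_tmul,
      π.inner_apply_left, σ.inner_apply_left, inv_inv, ← π.mul_apply, ← σ.mul_apply]
    rfl
  -- At the vector `1` of the trivial representation the form is `∫ F`, the quadratic form of `σ` at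
  -- `v`.
  have key := inner_integrated_nonneg_of_weaklyContained
    (trivialRep_weaklyContained_regularRep μ hH)
    (inner_regularRep_integrated_nonneg μ F hw hF) 1
  rw [UnitaryRep.inner_integrated] at key ⊢
  simp only [trivialRep_apply, RCLike.inner_apply, map_one, mul_one] at key
  exact key

end Amenable

/-! ### Positivity in the group `C*`-algebra -/

section CStar

/-- A positive element of a closed `*`-subalgebra of a `C*`-algebra has a square root there. -/
theorem exists_mem_star_mul_self_eq {A : Type*} [NonUnitalCStarAlgebra A]
    (S : NonUnitalStarSubalgebra ℂ A) [hS : IsClosed (S : Set A)] {a c : A}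
    (hac : a = star c * c) (haS : a ∈ S) : ∃ b ∈ S, a = star b * b := by
  let _ := CStarAlgebra.spectralOrder A
  have _ := CStarAlgebra.spectralOrderedRing A
  have ha : 0 ≤ a := hac ▸ star_mul_self_nonneg c
  have hq : ∀ x ∈ quasispectrum ℝ a, 0 ≤ x := quasispectrum_nonneg_of_nonneg a ha
  -- `c` may lie outside `S`; it only certifies `0 ≤ a`. Since `√0 = 0`, the non-unital calculus
  -- keeps the root of `a` in the closed subalgebra.
  refine ⟨cfcₙ Real.sqrt a, cfcₙ_mem Real.sqrt haS, ?_⟩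
  rw [← cfcₙ_star, ← cfcₙ_mul _ _ a]
  conv_lhs => rw [← cfcₙ_id ℝ a]
  refine cfcₙ_congr fun x hx => ?_
  simp [Real.mul_self_sqrt (hq x hx)]

universe u

variable {H : Type u} [Group H] [TopologicalSpace H]
  [MeasurableSpace H] [BorelSpace H]

/-- Factors chosen separately in each representation satisfy `‖c i‖² = ‖π_i(f)‖ ≤ ‖f‖₁`, so they
form a bounded family, an element of the `ℓ^∞`-product. The functional calculus then replaces it by
a factor in `C*(H)`. -/
theorem isPositiveInGroupCStar_of_isPositive (μ : Measure H) [IsFiniteMeasureOnCompacts μ]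
    (f : C_c(H, ℂ)) (hf : ∀ i : HilbertRep.{u} H, (i.rep.integrated μ f).IsPositive) :
    IsPositiveInGroupCStar μ f := by
  have hc : ∃ c : lp (fun i : HilbertRep.{u} H => i.space →L[ℂ] i.space) ∞,
      universalRep μ f = star c * c := by
    have h (i : HilbertRep.{u} H) := (CStarAlgebra.nonneg_iff_eq_star_mul_self).1
      ((ContinuousLinearMap.nonneg_iff_isPositive _).2 (hf i))
    choose c hc using h
    have hnorm (i : HilbertRep.{u} H) : ‖c i‖ ^ 2 ≤ ∫ h, ‖f h‖ ∂μ := by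
      rw [sq, ← CStarRing.norm_star_mul_self, ← hc]
      exact norm_opIntegral_le ..
    refine ⟨⟨c, memℓp_infty ⟨√(∫ h, ‖f h‖ ∂μ), ?_⟩⟩, ?_⟩
    · rintro _ ⟨i, rfl⟩
      exact Real.le_sqrt_of_sq_le (hnorm i)
    · ext1
      funext i
      exact hc i
  obtain ⟨c, hc⟩ := hc
  have : IsClosed (groupCStar μ : Set (lp (fun i : HilbertRep.{u} H =>
    i.space →L[ℂ] i.space) ∞)) := NonUnitalStarSubalgebra.isClosed_topologicalClosure _
  obtain ⟨b, hb, hfb⟩ := exists_mem_star_mul_self_eq (groupCStar μ) hc (toGroupCStar μ f).2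
  exact ⟨⟨b, hb⟩, Subtype.ext hfb⟩

end CStar

end Rigging

theorem proposition2
    {H : Type*} [Group H] [TopologicalSpace H] [IsTopologicalGroup H]
    [LocallyCompactSpace H] [T2Space H] [MeasurableSpace H] [BorelSpace H]
    (μ : Measure H) [μ.IsHaarMeasure] [μ.Regular] [μ.IsMulRightInvariant]
    {𝓗 : Type*} [NormedAddCommGroup 𝓗] [InnerProductSpace ℂ 𝓗] [CompleteSpace 𝓗]
    (π : UnitaryRep H 𝓗) (L : Submodule ℂ 𝓗)
    (hL : ∀ ψ φ : L, HasCompactSupport fun h => inner ℂ (ψ : 𝓗) (π.toHom h (φ : 𝓗)))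
    {𝒜 : Type*} [NonUnitalRing 𝒜] [StarRing 𝒜] [Module ℂ 𝒜] [IsScalarTower ℂ 𝒜 𝒜]
    [SMulCommClass ℂ 𝒜 𝒜] [StarModule ℂ 𝒜]
    (ρ : 𝒜 →⋆ₙₐ[ℂ] (𝓗 →L[ℂ] 𝓗))
    (hρ : ∀ (A : 𝒜) (h : H) (φ : 𝓗), ρ A (π.toHom h φ) = π.toHom h (ρ A φ)) :
    (∀ (hB : ∀ (φ : L) (f : C_c(H, ℂ)), π.integratedInv μ f (φ : 𝓗) ∈ L)
        (hA : ∀ (A : 𝒜) (φ : L), ρ A (φ : 𝓗) ∈ L),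
      IsRiggingMap μ (fun (φ : L) f => (⟨π.integratedInv μ f (φ : 𝓗), hB φ f⟩ : L))
        (fun A (φ : L) => (⟨ρ A (φ : 𝓗), hA A φ⟩ : L)) (riggingMap π L hL)) ∧
    (IsAmenable H → ∀ ψ : L, IsPositiveInGroupCStar μ (riggingMap π L hL ψ ψ)) ∧
    (∀ (K : Type*) [NormedAddCommGroup K] [InnerProductSpace ℂ K] [CompleteSpace K]
        (σ : UnitaryRep H K),
      WeaklyContained σ (regularRep μ) → IsLPositive σ μ (riggingMap π L hL)) := by
  refine ⟨fun hB hA => ?_, fun hH ψ => ?_, fun K _ _ _ σ hσ => ?_⟩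
  · exact isRiggingMap_riggingMap μ π L hL (fun A => ρ A) (map_star ρ) hρ hB hA
  · exact isPositiveInGroupCStar_of_isPositive μ _ fun i =>
      riggingMap_isLPositive_of_isAmenable μ hH π L hL i.rep ψ
  · exact riggingMap_isLPositive_of_weaklyContained μ π L hL σ hσ
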